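/- There is an absolute constant $C>0$ such that the following holds. Here a probabilistic polynomial of degree at most $d$ on $\{0,1\}^n$ is a probability distribution on real polynomials in $n$ variables, each of total degree at most $d$. (1) For every integer $n\ge 1$, all reals $s\ge 1$, $t\in\mathbb R$ and $\varepsilon\in(0,1]$, there is a probabilistic polynomial $\widetilde P=\widetilde P_{n,s,t,\varepsilon}:\{0,1\}^n\to\mathbb R$ of degree at most $C\,(1/\varepsilon)^{1/3}\log s$ such that for each fixed $x\in\{0,1\}^n$ (with probability over the draw of $\widetilde P$): (a) if $\sum_{i=1}^n x_i\le t$, then $|\widetilde P(x)|\le 1$ with probability at least $1-1/s$; (b) if $\sum_{i=1}^n x_i\in(t,t+\varepsilon n)$, then $\widetilde P(x)>1$ with probability at least $1-1/s$; (c) if $\sum_{i=1}^n x_i\ge t+\varepsilon n$, then $\widetilde P(x)\ge s$ with probability at least $1-1/s$. (2) In the exact setting $\varepsilon=1/n$, for every integer $n\ge1$ and all reals $s\ge1$ and $t\in\mathbb R$, there is a probabilistic polynomial of degree at most $C\,n^{1/3}\log^{2/3}(ns)$ that satisfies (a), (b) and (c) with $\varepsilon=1/n$. -/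

import Mathlib

/-- A bit, read as the real number `0` or `1`. -/
def bitReal (b : Bool) : ℝ := if b then 1 else 0

/-- The value of a real polynomial in `n` variables at a point of `{0,1}^n`. -/
noncomputable def evalBits {n : ℕ} (p : MvPolynomial (Fin n) ℝ) (x : Fin n → Bool) : ℝ :=
  MvPolynomial.eval (fun i => bitReal (x i)) p

/-- The number of ones of `x`, i.e. `∑ i, x i`, as a real number. -/
def bitSum {n : ℕ} (x : Fin n → Bool) : ℝ := ∑ i, bitReal (x i)

/-- A probabilistic polynomial on `{0,1}^n` over the reals: a (discrete) probability distribution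
on real polynomials in `n` variables. -/
abbrev ProbPoly (n : ℕ) := PMF (MvPolynomial (Fin n) ℝ)

/-- Every polynomial in the support of the distribution has total degree at most `d`. -/
def ProbPoly.DegreeLE {n : ℕ} (D : ProbPoly n) (d : ℝ) : Prop :=
  ∀ p ∈ D.support, (p.totalDegree : ℝ) ≤ d

/-- The probability that a polynomial drawn from `D` satisfies `E`. -/
noncomputable def ProbPoly.prob {n : ℕ} (D : ProbPoly n)
    (E : MvPolynomial (Fin n) ℝ → Prop) : ENNReal :=
  D.toOuterMeasure {p | E p}

/-- The threshold behaviour of a probabilistic PTF for `∑ i, x i > t`, with additive gap `ε n`,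
large value `s` and error `1 / s`. The input `x` is fixed before the polynomial is drawn. -/
def ProbPoly.IsThresholdPTF {n : ℕ} (D : ProbPoly n) (s t ε : ℝ) : Prop :=
  ∀ x : Fin n → Bool,
    (bitSum x ≤ t →
      ENNReal.ofReal (1 - 1 / s) ≤ D.prob (fun p => |evalBits p x| ≤ 1)) ∧
    (t < bitSum x → bitSum x < t + ε * n →
      ENNReal.ofReal (1 - 1 / s) ≤ D.prob (fun p => 1 < evalBits p x)) ∧
    (t + ε * n ≤ bitSum x →
      ENNReal.ofReal (1 - 1 / s) ≤ D.prob (fun p => s ≤ evalBits p x))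

open Finset

/-! A Chebyshev polynomial of `∑ x i` that is bounded on all of `[0, t]` would need degree about
`ε^(-1/2) log s`. Randomness shortens the interval. Sample `r` bits and multiply by a polynomial
computing the threshold function of the sample. By Hoeffding this factor is 1 when the sum exceeds
`t` and 0 when it is below `t - W`, where `W ≈ n √(log s / r)`. The univariate factor then only has
to be bounded on a window of length `W` below `t` (`exists_thresholdPTF_of_window`).

The sample factor has degree `O(√(r log s))` by the recursion in `exists_threshold_family`: a sample
of a quarter of the bits settles all inputs except those near the threshold, and there interpolation
is exact.

For (1) the univariate factor is a Chebyshev polynomial rescaled to the window. For (2) it only has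
to be bounded at integers, so `exists_poly_integer_gap` places roots at the integers nearest the
threshold, which gives degree `O(√(W log s))`. In both cases `r` balances the two degrees. -/

lemma bitReal_nonneg (b : Bool) : 0 ≤ bitReal b := by cases b <;> simp [bitReal]

lemma bitReal_le_one (b : Bool) : bitReal b ≤ 1 := by cases b <;> simp [bitReal]

/-! ### Hoeffding bounds for sampling with replacement -/

/-- The secant of `exp` over `[-l, l]` lies above its graph. -/
lemma exp_mul_le_cosh_add_sinh (l a : ℝ) (ha : |a| ≤ 1) :
    Real.exp (l * a) ≤ Real.cosh l + a * Real.sinh l := by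
  obtain ⟨h1, h2⟩ := abs_le.mp ha
  have h := convexOn_exp.2 (Set.mem_univ l) (Set.mem_univ (-l))
    (show (0 : ℝ) ≤ (1 + a) / 2 by linarith) (show (0 : ℝ) ≤ (1 - a) / 2 by linarith) (by ring)
  simp only [smul_eq_mul] at h
  rw [Real.cosh_eq, Real.sinh_eq]
  have e : (1 + a) / 2 * l + (1 - a) / 2 * -l = l * a := by ring
  rw [e] at h
  linarith

lemma sum_exp_mul_le {n : ℕ} (a : Fin n → ℝ) (ha : ∀ i, |a i| ≤ 1) (h0 : ∑ i, a i = 0) (l : ℝ) :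
    ∑ i, Real.exp (l * a i) ≤ n * Real.exp (l ^ 2 / 2) := by
  calc ∑ i, Real.exp (l * a i) ≤ ∑ i, (Real.cosh l + a i * Real.sinh l) :=
        sum_le_sum fun i _ => exp_mul_le_cosh_add_sinh l (a i) (ha i)
    _ = n * Real.cosh l := by rw [sum_add_distrib, ← sum_mul, h0]; simp
    _ ≤ _ := by gcongr; exact Real.cosh_le_exp_half_sq l

/-- One-sided Hoeffding bound, in counting form, for sampling with replacement. -/
lemma card_sum_sample_gt_le {n m : ℕ} (hm : 0 < m) (a : Fin n → ℝ) (ha : ∀ i, |a i| ≤ 1)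
    (h0 : ∑ i, a i = 0) (w : ℝ) (hw : 0 ≤ w) :
    ((univ.filter fun f : Fin m → Fin n => w < ∑ j, a (f j)).card : ℝ) ≤
      Real.exp (-(w ^ 2 / (2 * m))) * (n : ℝ) ^ m := by
  have hm' : (0 : ℝ) < m := by exact_mod_cast hm
  -- The minimiser of the Chernoff exponent `m l² / 2 - l w`.
  set l := w / m with hl
  have hl0 : 0 ≤ l := by positivity
  have hsum : ∑ f : Fin m → Fin n, Real.exp (l * ∑ j, a (f j)) =
      (∑ i, Real.exp (l * a i)) ^ m := by
    rw [Finset.sum_pow' univ (fun i => Real.exp (l * a i)) m]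
    simp [mul_sum, Real.exp_sum]
  -- Markov's inequality for the exponential moment.
  have hmark : ((univ.filter fun f : Fin m → Fin n => w < ∑ j, a (f j)).card : ℝ) *
      Real.exp (l * w) ≤ ∑ f : Fin m → Fin n, Real.exp (l * ∑ j, a (f j)) := by
    rw [← nsmul_eq_mul]
    refine (card_nsmul_le_sum _ _ _ ?_).trans
      (sum_le_sum_of_subset_of_nonneg (filter_subset _ _) fun _ _ _ => (Real.exp_pos _).le)
    intro f hf
    exact Real.exp_le_exp.mpr (mul_le_mul_of_nonneg_left (mem_filter.mp hf).2.le hl0)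
  have hpow : (∑ i, Real.exp (l * a i)) ^ m ≤ (n * Real.exp (l ^ 2 / 2)) ^ m :=
    pow_le_pow_left₀ (sum_nonneg fun _ _ => (Real.exp_pos _).le) (sum_exp_mul_le a ha h0 l) m
  have h := (hmark.trans hsum.le).trans hpow
  rw [mul_pow, ← Real.exp_nat_mul] at h
  have he : Real.exp (-(w ^ 2 / (2 * m))) * (n : ℝ) ^ m * Real.exp (l * w) =
      (n : ℝ) ^ m * Real.exp (m * (l ^ 2 / 2)) := by
    rw [mul_right_comm, ← Real.exp_add, mul_comm]
    congr 2
    rw [hl]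
    field_simp
    ring
  rw [← he] at h
  exact le_of_mul_le_mul_right h (Real.exp_pos _)

lemma bitSum_nonneg {n : ℕ} (x : Fin n → Bool) : 0 ≤ bitSum x :=
  sum_nonneg fun i _ => bitReal_nonneg (x i)

lemma bitSum_le {n : ℕ} (x : Fin n → Bool) : bitSum x ≤ n := by
  simpa [bitSum] using sum_le_sum fun i (_ : i ∈ univ) => bitReal_le_one (x i)

lemma exists_nat_bitSum_eq {n : ℕ} (x : Fin n → Bool) : ∃ k : ℕ, k ≤ n ∧ bitSum x = k := by
  refine ⟨(univ.filter fun i => x i = true).card, (card_le_univ _).trans_eq (by simp), ?_⟩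
  simp [bitSum, bitReal]

/-- Hoeffding's bound, in counting form, for the number of ones in a sample of `m` bits. -/
lemma card_sample_deviation_le {n m : ℕ} (hn : 0 < n) (hm : 0 < m) (x : Fin n → Bool) (w : ℝ)
    (hw : 0 ≤ w) :
    ((univ.filter fun f : Fin m → Fin n => w < |bitSum (x ∘ f) - m * bitSum x / n|).card : ℝ) ≤
      2 * Real.exp (-(w ^ 2 / (2 * m))) * (n : ℝ) ^ m := by
  have hn' : (0 : ℝ) < n := by exact_mod_cast hn
  set p := bitSum x / n with hp
  have hp0 : 0 ≤ p := div_nonneg (bitSum_nonneg x) hn'.le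
  have hp1 : p ≤ 1 := (div_le_one hn').mpr (bitSum_le x)
  set a : Fin n → ℝ := fun i => bitReal (x i) - p with ha
  have ha1 : ∀ i, |a i| ≤ 1 := fun i => by
    have := bitReal_nonneg (x i)
    have := bitReal_le_one (x i)
    exact abs_le.mpr ⟨by simp only [ha]; linarith, by simp only [ha]; linarith⟩
  have ha0 : ∑ i, a i = 0 := by
    simp only [ha, sum_sub_distrib, sum_const, card_univ, Fintype.card_fin, nsmul_eq_mul]
    rw [hp, mul_div_cancel₀ _ hn'.ne', bitSum, sub_self]
  have hs : ∀ f : Fin m → Fin n, bitSum (x ∘ f) - m * bitSum x / n = ∑ j, a (f j) := fun f => by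
    simp [ha, bitSum, hp, mul_div_assoc]
  have h1 := card_sum_sample_gt_le hm a ha1 ha0 w hw
  have h2 := card_sum_sample_gt_le (m := m) hm (fun i => -a i) (fun i => by simpa using ha1 i)
    (by simpa using ha0) w hw
  have hsub : (univ.filter fun f : Fin m → Fin n =>
      w < |bitSum (x ∘ f) - m * bitSum x / n|) ⊆
      (univ.filter fun f : Fin m → Fin n => w < ∑ j, a (f j)) ∪
      (univ.filter fun f : Fin m → Fin n => w < ∑ j, -a (f j)) := by
    intro f hf
    rw [mem_filter, hs, lt_abs] at hf
    simpa using hf.2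
  have hc : ((univ.filter fun f : Fin m → Fin n =>
      w < |bitSum (x ∘ f) - m * bitSum x / n|).card : ℝ) ≤
      (univ.filter fun f : Fin m → Fin n => w < ∑ j, a (f j)).card +
      (univ.filter fun f : Fin m → Fin n => w < ∑ j, -a (f j)).card := by
    exact_mod_cast (card_le_card hsub).trans (card_union_le _ _)
  linarith

/-! ### Symmetric polynomials and uniform random seeds -/

lemma evalBits_rename {n m : ℕ} (p : MvPolynomial (Fin m) ℝ) (f : Fin m → Fin n)
    (x : Fin n → Bool) : evalBits (MvPolynomial.rename f p) x = evalBits p (x ∘ f) := by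
  rw [evalBits, MvPolynomial.eval_rename]
  rfl

/-- The symmetric polynomial `R (∑ i, X i)`. -/
noncomputable def symPoly (n : ℕ) (R : Polynomial ℝ) : MvPolynomial (Fin n) ℝ :=
  Polynomial.aeval (∑ i, MvPolynomial.X i) R

lemma evalBits_symPoly {n : ℕ} (R : Polynomial ℝ) (x : Fin n → Bool) :
    evalBits (symPoly n R) x = R.eval (bitSum x) := by
  have h := Polynomial.aeval_algHom_apply
    (MvPolynomial.aeval (R := ℝ) fun i => bitReal (x i)) (∑ i, MvPolynomial.X i) R
  simp only [map_sum, MvPolynomial.aeval_X] at h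
  rw [Polynomial.coe_aeval_eq_eval] at h
  rw [evalBits, symPoly, ← MvPolynomial.coe_aeval_eq_eval]
  exact h.symm

lemma totalDegree_symPoly_le {n : ℕ} (R : Polynomial ℝ) :
    (symPoly n R).totalDegree ≤ R.natDegree := by
  rw [symPoly, Polynomial.aeval_eq_sum_range]
  refine MvPolynomial.totalDegree_finsetSum_le fun i hi => ?_
  refine (MvPolynomial.totalDegree_smul_le _ _).trans ((MvPolynomial.totalDegree_pow _ _).trans ?_)
  have h : (∑ i : Fin n, (MvPolynomial.X i : MvPolynomial (Fin n) ℝ)).totalDegree ≤ 1 :=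
    MvPolynomial.totalDegree_finsetSum_le fun i _ => (MvPolynomial.totalDegree_X i).le
  exact (Nat.mul_le_mul_left i h).trans (by have := mem_range.mp hi; omega)

/-- Uniform seeds are turned into a probabilistic polynomial. -/
noncomputable def seedPoly {n : ℕ} {Ω : Type} [Fintype Ω] [Nonempty Ω]
    (P : Ω → MvPolynomial (Fin n) ℝ) : ProbPoly n :=
  (PMF.uniformOfFintype Ω).map P

lemma degreeLE_seedPoly {n : ℕ} {Ω : Type} [Fintype Ω] [Nonempty Ω]
    {P : Ω → MvPolynomial (Fin n) ℝ} {d : ℝ} (h : ∀ ω, ((P ω).totalDegree : ℝ) ≤ d) :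
    (seedPoly P).DegreeLE d := by
  intro p hp
  rw [seedPoly, PMF.mem_support_map_iff] at hp
  obtain ⟨ω, -, rfl⟩ := hp
  exact h ω

open Classical in
lemma le_prob_seedPoly {n : ℕ} {Ω : Type} [Fintype Ω] [Nonempty Ω]
    (P : Ω → MvPolynomial (Fin n) ℝ) (E : MvPolynomial (Fin n) ℝ → Prop) (δ : ℝ)
    (h : ((univ.filter fun ω => ¬ E (P ω)).card : ℝ) ≤ δ * Fintype.card Ω) :
    ENNReal.ofReal (1 - δ) ≤ (seedPoly P).prob E := by
  have hΩ : (0 : ℝ) < Fintype.card Ω := by exact_mod_cast Fintype.card_pos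
  have hsplit := card_filter_add_card_filter_not (s := (univ : Finset Ω)) (fun ω => E (P ω))
  rw [card_univ] at hsplit
  have hsplit' : ((univ.filter fun ω => E (P ω)).card : ℝ) +
      (univ.filter fun ω => ¬ E (P ω)).card = Fintype.card Ω := by exact_mod_cast hsplit
  rw [ProbPoly.prob, seedPoly, PMF.toOuterMeasure_map_apply,
    PMF.toOuterMeasure_uniformOfFintype_apply, Fintype.card_ofFinset]
  rw [ENNReal.ofReal_le_iff_le_toReal (by
    exact (ENNReal.div_lt_top (ENNReal.natCast_ne_top _) (by simp)).ne)]
  rw [ENNReal.toReal_div, ENNReal.toReal_natCast, ENNReal.toReal_natCast, le_div_iff₀ hΩ]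
  simp only [Set.mem_preimage, Set.mem_ofPred_eq]
  linarith

/-! ### Exact threshold functions by recursive sampling -/

/-- A polynomial of low degree computing the threshold function exactly on the integers of a short
window around the threshold. -/
lemma exists_interpolant_near_threshold (n : ℕ) (θ c : ℝ) (hc : 0 ≤ c) :
    ∃ A : Polynomial ℝ, (A.natDegree : ℝ) ≤ 2 * c ∧ A.natDegree ≤ n ∧
      ∀ k : ℕ, k ≤ n → |(k : ℝ) - θ| ≤ c → A.eval (k : ℝ) = if θ < k then 1 else 0 := by
  classical
  set S := (range (n + 1)).filter fun k : ℕ => |(k : ℝ) - θ| ≤ c with hS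
  have hinj : Set.InjOn (fun k : ℕ => (k : ℝ)) S := Nat.cast_injective.injOn
  have hcard : S.card ≤ n + 1 := (card_filter_le _ _).trans (by simp)
  have hcard' : (S.card : ℝ) ≤ 2 * c + 1 := by
    have h : S.card ≤ (Finset.Icc ⌈θ - c⌉ ⌊θ + c⌋).card := by
      refine card_le_card_of_injOn (fun k : ℕ => (k : ℤ)) (fun k hk => ?_) (by simp)
      obtain ⟨h1, h2⟩ := abs_le.mp (mem_filter.mp hk).2
      simp only [coe_Icc, Set.mem_Icc]
      exact ⟨Int.ceil_le.mpr (by push_cast; linarith), Int.le_floor.mpr (by push_cast; linarith)⟩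
    rw [Int.card_Icc] at h
    have h1 := Int.le_ceil (θ - c)
    have h2 := Int.floor_le (θ + c)
    rcases le_total (⌊θ + c⌋ + 1 - ⌈θ - c⌉) 0 with h0 | h0
    · rw [Int.toNat_of_nonpos h0] at h
      have : (S.card : ℝ) ≤ 0 := by exact_mod_cast h
      linarith
    · have h3 : (S.card : ℤ) ≤ ⌊θ + c⌋ + 1 - ⌈θ - c⌉ := by omega
      have h4 : (S.card : ℝ) ≤ ⌊θ + c⌋ + 1 - ⌈θ - c⌉ := by exact_mod_cast h3
      linarith
  set A := Lagrange.interpolate S (fun k : ℕ => (k : ℝ))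
    (fun k : ℕ => if θ < (k : ℝ) then (1 : ℝ) else 0) with hA
  have hdeg : A.natDegree ≤ S.card - 1 :=
    Polynomial.natDegree_le_of_degree_le (Lagrange.degree_interpolate_le _ hinj)
  refine ⟨A, ?_, by omega, fun k hk hkc => ?_⟩
  · have h1 : (A.natDegree : ℝ) ≤ ((S.card - 1 : ℕ) : ℝ) := by exact_mod_cast hdeg
    refine h1.trans ?_
    rcases Nat.eq_zero_or_pos S.card with h0 | h0
    · rw [h0]
      simpa using hc
    · rw [Nat.cast_sub h0]
      push_cast
      linarith
  · exact Lagrange.eval_interpolate_at_node _ hinj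
      (mem_filter.mpr ⟨mem_range.mpr (by omega), hkc⟩)

/-- The family `P θ` of polynomials computes every threshold function `θ < ∑ i, x i` at `x`. -/
def ComputesThresholds {n : ℕ} (P : ℝ → MvPolynomial (Fin n) ℝ) (x : Fin n → Bool) : Prop :=
  ∀ θ, evalBits (P θ) x = if θ < bitSum x then 1 else 0

-- Union bound over two independent seeds: the bound on the second failure is uniform in the first
-- seed, so it survives summation over that seed.
open Classical in
lemma card_prod_bad_le {α β : Type*} [Fintype α] [Fintype β] (G : α → Prop) (H : α → β → Prop)
    (δ₁ δ₂ : ℝ) (h₁ : ((univ.filter fun a => ¬ G a).card : ℝ) ≤ δ₁ * Fintype.card α)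
    (h₂ : ∀ a, ((univ.filter fun b => ¬ H a b).card : ℝ) ≤ δ₂ * Fintype.card β) :
    ((univ.filter fun p : α × β => ¬ (G p.1 ∧ H p.1 p.2)).card : ℝ) ≤
      (δ₁ + δ₂) * Fintype.card (α × β) := by
  have hsub : (univ.filter fun p : α × β => ¬ (G p.1 ∧ H p.1 p.2)) ⊆
      (univ.filter fun a => ¬ G a) ×ˢ univ ∪ univ.filter fun p : α × β => ¬ H p.1 p.2 := by
    intro p hp
    simp only [mem_filter, mem_univ, true_and, mem_union, mem_product, and_true] at hp ⊢
    tauto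
  have hcard : (univ.filter fun p : α × β => ¬ H p.1 p.2).card =
      ∑ a, (univ.filter fun b => ¬ H a b).card := by
    simp only [card_filter, Fintype.sum_prod_type]
  have h := (card_le_card hsub).trans (card_union_le _ _)
  rw [hcard, card_product, card_univ] at h
  have h' : ((univ.filter fun p : α × β => ¬ (G p.1 ∧ H p.1 p.2)).card : ℝ) ≤
      (univ.filter fun a => ¬ G a).card * Fintype.card β +
      ∑ a, ((univ.filter fun b => ¬ H a b).card : ℝ) := by exact_mod_cast h
  have h3 : ∑ a, ((univ.filter fun b => ¬ H a b).card : ℝ) ≤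
      Fintype.card α * (δ₂ * Fintype.card β) := by
    simpa using sum_le_sum fun a (_ : a ∈ univ) => h₂ a
  rw [Fintype.card_prod]
  push_cast
  nlinarith [mul_le_mul_of_nonneg_right h₁ (Nat.cast_nonneg (α := ℝ) (Fintype.card β))]

open Classical in
/-- Draw a sample of `m` bits and then a family for the sampled input. Except with small
probability, the sample is balanced and the family computes all thresholds on the sample. -/
lemma card_sampled_bad_le {n m : ℕ} (hn : 0 < n) (hm : 0 < m) {Ω : Type} [Fintype Ω]
    (Q : Ω → ℝ → MvPolynomial (Fin m) ℝ) (Z δ : ℝ) (hZ : 0 ≤ Z)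
    (hQ : ∀ y, ((univ.filter fun ω => ¬ ComputesThresholds (Q ω) y).card : ℝ) ≤
      δ * Fintype.card Ω) (x : Fin n → Bool) :
    ((univ.filter fun p : (Fin m → Fin n) × Ω =>
      ¬ (|bitSum (x ∘ p.1) - m * bitSum x / n| ≤ √(2 * m * Z) ∧
        ComputesThresholds (Q p.2) (x ∘ p.1))).card : ℝ) ≤
      (2 * Real.exp (-Z) + δ) * Fintype.card ((Fin m → Fin n) × Ω) := by
  refine card_prod_bad_le (fun f : Fin m → Fin n => |bitSum (x ∘ f) - m * bitSum x / n| ≤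
    √(2 * m * Z)) (fun f ω => ComputesThresholds (Q ω) (x ∘ f)) _ _ ?_ fun f => hQ (x ∘ f)
  have hm' : (0 : ℝ) < m := by exact_mod_cast hm
  have h := card_sample_deviation_le hn hm x (√(2 * m * Z)) (Real.sqrt_nonneg _)
  rw [Real.sq_sqrt (by positivity), mul_div_cancel_left₀ _ (by positivity)] at h
  simpa [not_le] using h

open Classical in
/-- Probabilistic polynomials of degree `O(√(n L))` computing all threshold functions on `n` bits
with error `exp (-L)`. -/
lemma exists_threshold_family (n : ℕ) (hn : 0 < n) : ∀ L : ℝ, 1 ≤ L →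
    ∃ (Ω : Type) (_ : Fintype Ω) (_ : Nonempty Ω) (Q : Ω → ℝ → MvPolynomial (Fin n) ℝ),
      (∀ ω θ, ((Q ω θ).totalDegree : ℝ) ≤ 100 * √(n * L)) ∧
      ∀ x, ((univ.filter fun ω => ¬ ComputesThresholds (Q ω) x).card : ℝ) ≤
        Real.exp (-L) * Fintype.card Ω := by
  induction n using Nat.strong_induction_on with
  | _ n ih =>
  intro L hL
  have hn' : (1 : ℝ) ≤ n := by exact_mod_cast hn
  rcases lt_or_ge n 4 with h4 | h4
  -- Base case: the radius `n + |θ|` makes the window contain all of `0, …, n`, so interpolation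
  -- alone is exact, with degree below 4.
  · choose A hA1 hA2 hA3 using fun θ : ℝ =>
      exists_interpolant_near_threshold n θ (n + |θ|) (by positivity)
    refine ⟨Unit, inferInstance, inferInstance, fun _ θ => symPoly n (A θ), fun _ θ => ?_,
      fun x => ?_⟩
    · have h1 : ((symPoly n (A θ)).totalDegree : ℝ) ≤ 4 := by
        exact_mod_cast (totalDegree_symPoly_le (A θ)).trans ((hA2 θ).trans h4.le)
      have h2 : 1 ≤ √(n * L) := Real.one_le_sqrt.mpr (one_le_mul_of_one_le_of_one_le hn' hL)
      linarith
    · have : ∀ ω : Unit, ComputesThresholds (fun θ => symPoly n (A θ)) x := fun _ θ => by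
        obtain ⟨k, hk, hx⟩ := exists_nat_bitSum_eq x
        rw [evalBits_symPoly, hx]
        refine hA3 θ k hk ((abs_sub _ _).trans ?_)
        have : (k : ℝ) ≤ n := by exact_mod_cast hk
        rw [Nat.abs_cast]
        linarith
      rw [filter_false_of_mem fun ω _ => not_not_intro (this ω)]
      simpa using (Real.exp_pos _).le
  · set m := n / 4 with hm
    have hm0 : 0 < m := by omega
    have hm0' : (0 : ℝ) < m := by exact_mod_cast hm0
    have hm4 : (m : ℝ) * 4 ≤ n := by exact_mod_cast Nat.div_mul_le_self n 4
    have hm8 : (n : ℝ) ≤ 8 * m := by exact_mod_cast (by omega : n ≤ 8 * m)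
    -- Asking for error `exp (-(L + 1))` leaves room for the sampling error `2 exp (-(L + 2))`.
    obtain ⟨Ω, _, _, Q, hQd, hQ⟩ := ih m (by omega) hm0 (L + 1) (by linarith)
    set w := √(2 * m * (L + 2)) with hw
    set B := w * n / m with hB
    have hB0 : 0 ≤ B := by positivity
    choose A hA1 _ hA3 using fun θ : ℝ =>
      exists_interpolant_near_threshold n θ (2 * B) (by positivity)
    -- With `U`, `V` the sample thresholds at `mθ/n + w` and `mθ/n - w`, the polynomial is `U + (V -
    -- U) A`. On a good seed it is 1 if `U = 1` and 0 if `V = 0`. Otherwise it is `A`, and the sum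
    -- is within `2B` of `θ`, where `A` is exact. One seed serves both thresholds, and all `θ`, so
    -- the recursive error is not doubled.
    refine ⟨(Fin m → Fin n) × Ω, inferInstance,
      ⟨fun _ => ⟨0, hn⟩, Classical.arbitrary Ω⟩, fun p θ =>
      MvPolynomial.rename p.1 (Q p.2 (m * θ / n + w)) +
        (MvPolynomial.rename p.1 (Q p.2 (m * θ / n - w)) -
          MvPolynomial.rename p.1 (Q p.2 (m * θ / n + w))) * symPoly n (A θ), ?_, ?_⟩
    · rintro ⟨f, ω⟩ θ
      -- From `m ≤ n / 4` and `L + 1 ≤ 2 L` the ratio is at most `√(1/2) < 0.72`. The remaining 28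
      -- of the 100 pays for `A`, of degree at most `4 B`.
      have hD : 100 * √(m * (L + 1)) ≤ 72 * √(n * L) := by
        have : √(m * (L + 1)) ≤ 0.72 * √(n * L) := by
          rw [Real.sqrt_le_iff]
          refine ⟨by positivity, ?_⟩
          rw [mul_pow, Real.sq_sqrt (by positivity)]
          nlinarith
        linarith
      have hr : ∀ θ', ((MvPolynomial.rename f (Q ω θ')).totalDegree : ℝ) ≤ 72 * √(n * L) :=
        fun θ' => (Nat.cast_le.mpr (MvPolynomial.totalDegree_rename_le _ _)).trans
          ((hQd ω θ').trans hD)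
      have hBs : B ≤ 7 * √(n * L) := by
        have h1 : B ^ 2 = 2 * (L + 2) * n * (n / m) := by
          rw [hB, div_pow, mul_pow, hw, Real.sq_sqrt (by positivity)]
          field_simp
        have h2 : (n : ℝ) / m ≤ 8 := (div_le_iff₀ hm0').mpr hm8
        refine le_of_sq_le_sq ?_ (by positivity)
        rw [h1, mul_pow, Real.sq_sqrt (by positivity)]
        have h3 : 2 * (L + 2) * n * (n / m) ≤ 2 * (L + 2) * n * 8 := by gcongr
        nlinarith
      have hA : ((symPoly n (A θ)).totalDegree : ℝ) ≤ 28 * √(n * L) := by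
        refine (Nat.cast_le.mpr (totalDegree_symPoly_le (A θ))).trans ((hA1 θ).trans ?_)
        linarith
      have h0 : 0 ≤ √(n * L) := Real.sqrt_nonneg _
      refine (Nat.cast_le.mpr (MvPolynomial.totalDegree_add _ _)).trans ?_
      rw [Nat.cast_max]
      refine max_le ((hr _).trans (by linarith)) ?_
      refine (Nat.cast_le.mpr ((MvPolynomial.totalDegree_mul _ _).trans
        (Nat.add_le_add_right (MvPolynomial.totalDegree_sub _ _) _))).trans ?_
      push_cast
      have := max_le (hr (m * θ / n - w)) (hr (m * θ / n + w))
      linarith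
    · intro x
      have h := card_sampled_bad_le hn hm0 Q (L + 2) _ (by linarith) hQ x
      have he : 2 * Real.exp (-(L + 2)) + Real.exp (-(L + 1)) ≤ Real.exp (-L) := by
        have e1 : Real.exp (-(L + 1)) = Real.exp (-L) * Real.exp (-1) := by
          rw [← Real.exp_add]; ring_nf
        have e2 : Real.exp (-(L + 2)) = Real.exp (-L) * (Real.exp (-1) * Real.exp (-1)) := by
          rw [← Real.exp_add, ← Real.exp_add]; ring_nf
        have e3 : Real.exp (-1) ≤ 1 / 2 := by
          rw [Real.exp_neg, ← one_div]
          exact one_div_le_one_div_of_le two_pos (by linarith [Real.add_one_le_exp (1 : ℝ)])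
        have e4 := Real.exp_pos (-1)
        have e5 : 2 * (Real.exp (-1) * Real.exp (-1)) + Real.exp (-1) ≤ 1 := by nlinarith
        rw [e1, e2]
        nlinarith [mul_le_mul_of_nonneg_left e5 (Real.exp_pos (-L)).le]
      refine le_trans ?_ (h.trans (mul_le_mul_of_nonneg_right he (Nat.cast_nonneg _)))
      refine Nat.cast_le.mpr (card_le_card fun p hp => ?_)
      rw [mem_filter] at hp ⊢
      refine ⟨mem_univ _, fun ⟨hdev, hcomp⟩ => hp.2 fun θ => ?_⟩
      obtain ⟨f, ω⟩ := p
      simp only at hdev hcomp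
      obtain ⟨d1, d2⟩ := abs_le.mp hdev
      have hU := hcomp (m * θ / n + w)
      have hV := hcomp (m * θ / n - w)
      simp only [← evalBits_rename] at hU hV
      have hev : ∀ a b c : MvPolynomial (Fin n) ℝ, evalBits (a + (b - a) * c) x =
          evalBits a x + (evalBits b x - evalBits a x) * evalBits c x := fun a b c => by
        simp [evalBits]
      simp only [hev]
      rw [hU, hV, evalBits_symPoly]
      have hn0 : (0 : ℝ) < n := by linarith
      have hmn : (m : ℝ) * (w * n / m) / n = w := by field_simp
      have hpos : (0 : ℝ) < m / n := by positivity
      have hw0 : 0 ≤ w := Real.sqrt_nonneg _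
      by_cases hu : m * θ / n + w < bitSum (x ∘ f)
      · have hθ : θ < bitSum x := by
          have : m / n * θ < m / n * bitSum x := by
            rw [div_mul_eq_mul_div, div_mul_eq_mul_div]; linarith
          exact lt_of_mul_lt_mul_left this hpos.le
        simp [hu, hθ, show m * θ / n - w < bitSum (x ∘ f) by linarith]
      · by_cases hv : m * θ / n - w < bitSum (x ∘ f)
        · obtain ⟨k, hk, hx⟩ := exists_nat_bitSum_eq x
          have hwin : |bitSum x - θ| ≤ 2 * B := by
            have : m / n * |bitSum x - θ| ≤ m / n * (2 * B) := by
              rw [← abs_of_pos hpos, ← abs_mul, abs_of_pos hpos, abs_le, mul_sub,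
                div_mul_eq_mul_div, div_mul_eq_mul_div, div_mul_eq_mul_div,
                show (m : ℝ) * (2 * B) / n = 2 * w by rw [hB]; field_simp]
              push Not at hu
              exact ⟨by linarith, by linarith⟩
            exact le_of_mul_le_mul_left this hpos
          rw [hx] at hwin ⊢
          rw [hA3 θ k hk hwin]
          simp [hu, hv]
        · have hθ : ¬ θ < bitSum x := by
            push Not at hv ⊢
            have : m / n * bitSum x ≤ m / n * θ := by
              rw [div_mul_eq_mul_div, div_mul_eq_mul_div]; linarith
            exact le_of_mul_le_mul_left this hpos
          simp [hu, hv, hθ]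

/-! ### Sample threshold times a window polynomial -/

/-- Multiplying a univariate polynomial, which only has to be bounded in a short window below the
threshold, by the threshold function of a sample of `r` bits. -/
lemma exists_thresholdPTF_of_window {n r : ℕ} (hn : 0 < n) (hr : 0 < r) {s : ℝ} (hs : 2 ≤ s)
    (t ε : ℝ) (R : Polynomial ℝ)
    (hlow : ∀ k : ℕ, k ≤ n → t - 2 * n * √(6 * Real.log s / r) < k → (k : ℝ) ≤ t →
      |R.eval (k : ℝ)| ≤ 1)
    (hmid : ∀ k : ℕ, k ≤ n → t < k → (k : ℝ) < t + ε * n → 1 < R.eval (k : ℝ))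
    (hhigh : ∀ k : ℕ, k ≤ n → t < k → t + ε * n ≤ k → s ≤ R.eval (k : ℝ)) (hε : 0 < ε) :
    ∃ D : ProbPoly n, D.DegreeLE (100 * √(r * (2 * Real.log s)) + R.natDegree) ∧
      D.IsThresholdPTF s t ε := by
  classical
  have hn' : (0 : ℝ) < n := by exact_mod_cast hn
  have hr' : (0 : ℝ) < r := by exact_mod_cast hr
  have hs0 : 0 < s := by linarith
  have hL : 0.69 < Real.log s :=
    lt_of_lt_of_le (by linarith [Real.log_two_gt_d9]) (Real.log_le_log two_pos hs)
  set L := Real.log s with hLdef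
  obtain ⟨Ω, _, _, Q, hQd, hQ⟩ := exists_threshold_family r hr (2 * L) (by linarith)
  set w := √(2 * r * (3 * L)) with hw
  have hw0 : 0 ≤ w := Real.sqrt_nonneg _
  have hW : 2 * n * √(6 * L / r) = 2 * w * n / r := by
    have : √(6 * L / r) = w / r := by
      rw [hw, show 6 * L / r = 2 * r * (3 * L) / r ^ 2 by field_simp; ring,
        Real.sqrt_div' _ (by positivity), Real.sqrt_sq hr'.le]
    rw [this]; ring
  rw [hW] at hlow
  have : Nonempty ((Fin r → Fin n) × Ω) := ⟨fun _ => ⟨0, hn⟩, Classical.arbitrary Ω⟩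
  -- The sample threshold is lowered by `w` so that every input with sum above `t` passes on a good
  -- seed. A passing input then has sum above `t - 2wn/r`, which is the window in `hlow`.
  set P : (Fin r → Fin n) × Ω → MvPolynomial (Fin n) ℝ := fun p =>
    MvPolynomial.rename p.1 (Q p.2 (r * t / n - w)) * symPoly n R with hP
  refine ⟨seedPoly P, degreeLE_seedPoly fun p => ?_, fun x => ?_⟩
  · refine (Nat.cast_le.mpr ((MvPolynomial.totalDegree_mul _ _).trans (Nat.add_le_add
      (MvPolynomial.totalDegree_rename_le _ _) (totalDegree_symPoly_le R)))).trans ?_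
    push_cast
    linarith [hQd p.2 (r * t / n - w)]
  · have h := card_sampled_bad_le hn hr Q (3 * L) _ (by linarith) hQ x
    -- The errors are `2 / s^3` from sampling and `1 / s^2` from the family; `s ≥ 2` is what makes
    -- their sum at most `1 / s`.
    have he : 2 * Real.exp (-(3 * L)) + Real.exp (-(2 * L)) ≤ 1 / s := by
      have e1 : ∀ k : ℕ, Real.exp (-(k * L)) = (1 / s) ^ k := fun k => by
        rw [Real.exp_neg, Real.exp_nat_mul, Real.exp_log hs0, one_div, inv_pow]
      have e2 := e1 2
      have e3 := e1 3
      push_cast at e2 e3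
      rw [e2, e3]
      have e4 : 1 / s ≤ 1 / 2 := one_div_le_one_div_of_le two_pos hs
      have e5 : 0 < 1 / s := by positivity
      nlinarith [mul_nonneg e5.le (sub_nonneg.mpr e4), mul_pos e5 e5]
    have hcard := h.trans (mul_le_mul_of_nonneg_right he (Nat.cast_nonneg _))
    obtain ⟨k, hk, hx⟩ := exists_nat_bitSum_eq x
    have hval : ∀ p : (Fin r → Fin n) × Ω,
        |bitSum (x ∘ p.1) - r * bitSum x / n| ≤ w ∧ ComputesThresholds (Q p.2) (x ∘ p.1) →
        (t < bitSum x → evalBits (P p) x = R.eval (bitSum x)) ∧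
        (bitSum x ≤ t → |evalBits (P p) x| ≤ 1) := by
      rintro ⟨f, ω⟩ ⟨hdev, hcomp⟩
      obtain ⟨d1, d2⟩ := abs_le.mp hdev
      have hev : evalBits (P (f, ω)) x = (if r * t / n - w < bitSum (x ∘ f) then 1 else 0) *
          R.eval (bitSum x) := by
        rw [← hcomp (r * t / n - w), ← evalBits_symPoly, ← evalBits_rename]
        simp [hP, evalBits]
      have hpos : (0 : ℝ) < r / n := by positivity
      refine ⟨fun ht => ?_, fun ht => ?_⟩
      · have h1 : r * t / n < r * bitSum x / n := by gcongr
        rw [hev, if_pos (by simp only at d1; linarith), one_mul]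
      · rw [hev]
        split_ifs with hc
        · rw [one_mul, hx]
          rw [hx] at ht d1 d2
          refine hlow k hk ?_ ht
          have h1 : r / n * (t - 2 * w * n / r) < r / n * k := by
            rw [mul_sub, div_mul_eq_mul_div, div_mul_eq_mul_div, div_mul_eq_mul_div,
              show (r : ℝ) * (2 * w * n / r) / n = 2 * w by field_simp]
            simp only at d2
            linarith
          exact lt_of_mul_lt_mul_left h1 hpos.le
        · simp
    have hprob : ∀ E : MvPolynomial (Fin n) ℝ → Prop,
        (∀ p : (Fin r → Fin n) × Ω, |bitSum (x ∘ p.1) - r * bitSum x / n| ≤ w ∧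
          ComputesThresholds (Q p.2) (x ∘ p.1) → E (P p)) →
        ENNReal.ofReal (1 - 1 / s) ≤ (seedPoly P).prob E := fun E hE => by
      refine le_prob_seedPoly P E _ (le_trans (Nat.cast_le.mpr (card_le_card fun p hp => ?_)) hcard)
      rw [mem_filter] at hp ⊢
      exact ⟨mem_univ _, fun hg => hp.2 (hE p hg)⟩
    refine ⟨fun ht => hprob _ fun p hp => (hval p hp).2 ht,
      fun ht ht' => hprob _ fun p hp => ?_, fun ht => hprob _ fun p hp => ?_⟩
    · rw [(hval p hp).1 ht, hx]
      rw [hx] at ht ht'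
      exact hmid k hk ht ht'
    · have ht' : t < bitSum x := lt_of_lt_of_le (by nlinarith) ht
      rw [(hval p hp).1 ht', hx]
      rw [hx] at ht ht'
      exact hhigh k hk ht' ht

/-! ### Chebyshev polynomials and growth past an integer gap -/

open Polynomial

/-- `T_d (cosh θ) = cosh (d θ) ≥ exp (d θ) / 2`, and `arcosh x ≥ √δ` because `cosh √δ ≤ exp (δ / 2)
≤ 1 / (1 - δ / 2) ≤ 1 + δ` for `δ ≤ 1`. -/
lemma le_eval_chebyshev (d : ℕ) {δ x s : ℝ} (hδ : 0 ≤ δ) (hδ1 : δ ≤ 1) (hx : 1 + δ ≤ x)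
    (hs : 0 < s) (hd : Real.log (2 * s) ≤ d * √δ) : s ≤ (Chebyshev.T ℝ d).eval x := by
  have hx1 : 1 ≤ x := by linarith
  have h1 : Real.cosh √δ ≤ Real.cosh (Real.arcosh x) := by
    rw [Real.cosh_arcosh hx1]
    refine (Real.cosh_le_exp_half_sq _).trans (le_trans ?_ hx)
    rw [Real.sq_sqrt hδ]
    have h2 : 1 - δ / 2 ≤ Real.exp (-(δ / 2)) := by linarith [Real.add_one_le_exp (-(δ / 2))]
    rw [Real.exp_neg] at h2
    have h3 := Real.exp_pos (δ / 2)
    have h4 : (1 - δ / 2) * Real.exp (δ / 2) ≤ 1 := by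
      calc _ ≤ (Real.exp (δ / 2))⁻¹ * Real.exp (δ / 2) := by gcongr
        _ = 1 := inv_mul_cancel₀ h3.ne'
    have h5 : 1 ≤ (1 + δ) * (1 - δ / 2) := by nlinarith
    nlinarith
  have h2 : √δ ≤ Real.arcosh x := by
    have := Real.cosh_le_cosh.mp h1
    rwa [abs_of_nonneg (Real.sqrt_nonneg _), abs_of_nonneg (Real.arcosh_nonneg hx1)] at this
  rw [← Real.cosh_arcosh hx1, Chebyshev.T_real_cosh, Real.cosh_eq]
  have h3 : Real.log (2 * s) ≤ ((d : ℤ) : ℝ) * Real.arcosh x := by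
    push_cast
    exact hd.trans (by gcongr)
  have h4 : 2 * s ≤ Real.exp (((d : ℤ) : ℝ) * Real.arcosh x) := by
    rwa [← Real.log_le_iff_le_exp (by positivity)]
  have := Real.exp_pos (-(((d : ℤ) : ℝ) * Real.arcosh x))
  linarith

/-- The Chebyshev polynomial after the affine substitution `x ↦ b + c x`. -/
noncomputable def affineChebyshev (d : ℕ) (b c : ℝ) : ℝ[X] :=
  (Chebyshev.T ℝ d).comp (C b + C c * X)

lemma eval_affineChebyshev (d : ℕ) (b c x : ℝ) :
    (affineChebyshev d b c).eval x = (Chebyshev.T ℝ d).eval (b + c * x) := by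
  simp [affineChebyshev]

lemma natDegree_affineChebyshev_le (d : ℕ) (b c : ℝ) : (affineChebyshev d b c).natDegree ≤ d := by
  refine natDegree_comp_le.trans ?_
  have h : (C b + C c * X : ℝ[X]).natDegree ≤ 1 := by compute_degree
  rw [Chebyshev.natDegree_T]
  simpa using Nat.mul_le_mul_left d h

/-- Each term is at most `2 (√(k + 1) - √k)`, and the sum telescopes. -/
lemma sum_one_div_sqrt_le (a : ℕ) : ∑ k ∈ range a, 1 / √((k : ℝ) + 1) ≤ 2 * √a := by
  induction a with
  | zero => simp
  | succ a ih =>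
    rw [sum_range_succ]
    have h1 : 0 < √((a : ℝ) + 1) := Real.sqrt_pos.mpr (by positivity)
    have h2 : √(a : ℝ) ≤ √((a : ℝ) + 1) := Real.sqrt_le_sqrt (by linarith)
    have h3 : √(a : ℝ) ^ 2 = a := Real.sq_sqrt (by positivity)
    have h4 : √((a : ℝ) + 1) ^ 2 = a + 1 := Real.sq_sqrt (by positivity)
    have h5 : 1 / √((a : ℝ) + 1) ≤ 2 * √((a : ℝ) + 1) - 2 * √(a : ℝ) := by
      rw [div_le_iff₀ h1]
      nlinarith [sq_nonneg (√((a : ℝ) + 1) - √(a : ℝ))]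
    push_cast
    linarith

/-- A polynomial of degree `O(√(W / k))` bounded by `1` on `[0, W]`, vanishing at `k`, and at
least `1` on the negative half-line. -/
lemma exists_bounded_poly_root {W k : ℕ} (hk : 0 < k) (hW : 0 < W) :
    ∃ q : ℝ[X], (q.natDegree : ℝ) ≤ √W * (1 / √k) + 1 ∧ q.eval (k : ℝ) = 0 ∧
      (∀ y : ℝ, 0 ≤ y → y ≤ W → |q.eval y| ≤ 1) ∧ ∀ y : ℝ, y ≤ 0 → 1 ≤ q.eval y := by
  have hk' : (0 : ℝ) < k := by exact_mod_cast hk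
  have hW' : (0 : ℝ) < W := by exact_mod_cast hW
  set v := √W * (1 / √k) with hv
  have hv0 : 0 < v := by positivity
  set m := ⌈v⌉₊ with hm
  have hm0 : 0 < m := Nat.ceil_pos.mpr hv0
  have hm0' : (0 : ℝ) < m := by exact_mod_cast hm0
  have hvm : v ≤ m := Nat.le_ceil v
  have hmW : (W : ℝ) ≤ k * m ^ 2 := by
    have h1 : v ^ 2 = W / k := by
      rw [hv, mul_pow, div_pow, Real.sq_sqrt hW'.le, Real.sq_sqrt hk'.le]; ring
    have h2 : v ^ 2 ≤ (m : ℝ) ^ 2 := by gcongr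
    rw [h1, div_le_iff₀ hk'] at h2
    linarith
  -- The slope for which `y ↦ 1 - g y` sends `k` to `cos (π / (2m))`, the largest root of `T_m`. As
  -- `W ≤ k m²`, we get `g W ≤ 2`, so `[0, W]` stays inside `[-1, 1]`.
  set g := (1 - Real.cos (Real.pi / (2 * m))) / k with hg
  have hg0 : 0 ≤ g := div_nonneg (by linarith [Real.cos_le_one (Real.pi / (2 * m))]) hk'.le
  have hgW : W * g ≤ 2 := by
    have h1 := Real.one_sub_sq_div_two_le_cos (x := Real.pi / (2 * m))
    have h2 : Real.pi ^ 2 ≤ 16 := by nlinarith [Real.pi_le_four, Real.pi_pos]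
    have h3 : 1 - Real.cos (Real.pi / (2 * m)) ≤ 2 / m ^ 2 := by
      have : (Real.pi / (2 * m)) ^ 2 / 2 ≤ 2 / m ^ 2 := by
        rw [div_pow, mul_pow, div_div, div_le_div_iff₀ (by positivity) (by positivity)]
        nlinarith [sq_nonneg (m : ℝ)]
      linarith
    calc W * g ≤ (k * m ^ 2) * (2 / m ^ 2 / k) := by
          rw [hg]; gcongr
      _ = 2 := by field_simp
  refine ⟨affineChebyshev m 1 (-g), ?_, ?_, fun y hy hyW => ?_, fun y hy => ?_⟩
  · exact (Nat.cast_le.mpr (natDegree_affineChebyshev_le _ _ _)).trans (Nat.ceil_lt_add_one hv0.le).le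
  · rw [eval_affineChebyshev, show 1 + -g * k = Real.cos (Real.pi / (2 * m)) by
      rw [hg]; field_simp; ring, Chebyshev.T_real_cos,
      show ((m : ℤ) : ℝ) * (Real.pi / (2 * m)) = Real.pi / 2 by push_cast; field_simp,
      Real.cos_pi_div_two]
  · rw [eval_affineChebyshev]
    refine Chebyshev.abs_eval_T_real_le_one _ (abs_le.mpr ⟨?_, ?_⟩)
    · nlinarith [mul_le_mul_of_nonneg_left hyW hg0]
    · nlinarith
  · rw [eval_affineChebyshev]
    exact Chebyshev.one_le_eval_T_real _ (by nlinarith)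

/-- A polynomial of degree `O(√(W log s))` bounded by `1` at the integers `1, …, W` and at least
`s` on the negative half-line. -/
lemma exists_poly_integer_gap {W : ℕ} (hW : 0 < W) {s : ℝ} (hs : 2 ≤ s) :
    ∃ R : ℝ[X], (R.natDegree : ℝ) ≤ 12 * √(W * Real.log s) ∧
      (∀ y : ℕ, 1 ≤ y → y ≤ W → |R.eval (y : ℝ)| ≤ 1) ∧ ∀ y : ℝ, y ≤ 0 → s ≤ R.eval y := by
  have hW' : (0 : ℝ) < W := by exact_mod_cast hW
  have hs0 : 0 < s := by linarith
  have hL : 0.69 < Real.log s :=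
    lt_of_lt_of_le (by linarith [Real.log_two_gt_d9]) (Real.log_le_log two_pos hs)
  have hL2 : Real.log (2 * s) ≤ 2 * Real.log s := by
    rw [Real.log_mul two_ne_zero hs0.ne']
    linarith [Real.log_le_log two_pos hs]
  set L := Real.log s with hLdef
  set a := ⌈L⌉₊ with ha
  have hLa : L ≤ a := Nat.le_ceil L
  have haL : (a : ℝ) < L + 1 := Nat.ceil_lt_add_one (by linarith)
  have ha0 : 0 < a := Nat.ceil_pos.mpr (by linarith)
  have ha0' : (1 : ℝ) ≤ a := by exact_mod_cast ha0
  rcases le_or_gt a W with haW | haW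
  · have haW' : (a : ℝ) ≤ W := by exact_mod_cast haW
    -- The factors `q k` vanish at `1, …, a`, so the Chebyshev factor need only be bounded on `[a,
    -- W]`, and `y ≤ 0` lies at relative distance `a / W` from that interval. Its degree `≈ 2√(W a)`
    -- gives `d √(a / W) ≥ 2a ≥ log (2s)`, and the degrees `√(W / k)` of the root factors also sum
    -- to `O(√(W a))`.
    choose q hqd hq0 hqb hqn using fun k : ℕ => exists_bounded_poly_root (W := W) k.succ_pos hW
    set d := ⌈2 * √(W * a)⌉₊ with hd
    set R := affineChebyshev d (1 + 2 * a / W) (-(2 / W)) * ∏ k ∈ range a, q k with hR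
    have heval : ∀ y : ℝ, R.eval y = (Chebyshev.T ℝ d).eval (1 + 2 * (a - y) / W) *
        ∏ k ∈ range a, (q k).eval y := fun y => by
      rw [hR, eval_mul, eval_prod, eval_affineChebyshev]
      congr 2
      ring
    refine ⟨R, ?_, fun y hy hyW => ?_, fun y hy => ?_⟩
    · have h1 : ((∏ k ∈ range a, q k).natDegree : ℝ) ≤ 3 * √(W * a) := by
        have e1 : ((∏ k ∈ range a, q k).natDegree : ℝ) ≤ ∑ k ∈ range a, ((q k).natDegree : ℝ) := by
          exact_mod_cast natDegree_prod_le _ _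
        refine e1.trans ((sum_le_sum fun k _ => hqd k).trans ?_)
        rw [sum_add_distrib, ← mul_sum]
        simp only [sum_const, card_range, nsmul_eq_mul, mul_one, Nat.succ_eq_add_one, Nat.cast_add,
          Nat.cast_one]
        have e2 : √W * ∑ k ∈ range a, 1 / √((k : ℝ) + 1) ≤ √W * (2 * √a) := by
          gcongr; exact sum_one_div_sqrt_le a
        have e3 : (a : ℝ) ≤ √(W * a) := Real.le_sqrt_of_sq_le (by nlinarith)
        rw [Real.sqrt_mul hW'.le] at e3 ⊢
        linarith
      have h2 : (d : ℝ) ≤ 2 * √(W * a) + 1 := (Nat.ceil_lt_add_one (by positivity)).le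
      have h3 : 1 ≤ √(W * a) := Real.one_le_sqrt.mpr (by nlinarith)
      have h4 : √(W * a) ≤ 2 * √(W * L) := by
        rw [Real.sqrt_le_iff]
        refine ⟨by positivity, ?_⟩
        rw [mul_pow, Real.sq_sqrt (by positivity)]
        nlinarith
      have h5 : (R.natDegree : ℝ) ≤ d + (∏ k ∈ range a, q k).natDegree := by
        exact_mod_cast natDegree_mul_le.trans
          (Nat.add_le_add_right (natDegree_affineChebyshev_le _ _ _) _)
      linarith
    · rw [heval]
      rcases le_or_gt y a with hya | hya
      · have h0 : ∏ k ∈ range a, (q k).eval (y : ℝ) = 0 := by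
          refine prod_eq_zero (mem_range.mpr (show y - 1 < a by omega)) ?_
          have := hq0 (y - 1)
          rwa [show (y - 1).succ = y by omega] at this
        simp [h0]
      · have hya' : (a : ℝ) ≤ y := by exact_mod_cast hya.le
        have hyW' : (y : ℝ) ≤ W := by exact_mod_cast hyW
        rw [abs_mul, abs_prod]
        refine mul_le_one₀ (Chebyshev.abs_eval_T_real_le_one _ ?_)
          (prod_nonneg fun _ _ => abs_nonneg _)
          (prod_le_one (fun _ _ => abs_nonneg _) fun k _ => hqb k y (by positivity) hyW')
        have h1 : 2 * ((a : ℝ) - y) / W ≤ 0 :=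
          div_nonpos_of_nonpos_of_nonneg (by linarith) hW'.le
        have h2 : -2 ≤ 2 * ((a : ℝ) - y) / W := by rw [le_div_iff₀ hW']; linarith
        exact abs_le.mpr ⟨by linarith, by linarith⟩
    · rw [heval]
      have h1 : s ≤ (Chebyshev.T ℝ d).eval (1 + 2 * (a - y) / W) := by
        refine le_eval_chebyshev d (δ := a / W) (by positivity) ((div_le_one hW').mpr haW') ?_ hs0 ?_
        · have : (a : ℝ) / W ≤ 2 * (a - y) / W := by gcongr; linarith
          linarith
        · have h2 : 2 * √(W * a) ≤ d := Nat.le_ceil _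
          have h3 : √(W * a) * √(a / W) = a := by
            rw [← Real.sqrt_mul (by positivity), show (W : ℝ) * a * (a / W) = a ^ 2 by field_simp,
              Real.sqrt_sq (by positivity)]
          have h4 : 2 * √(W * a) * √(a / W) ≤ d * √(a / W) := by gcongr
          rw [mul_assoc, h3] at h4
          linarith
      have h2 : 1 ≤ ∏ k ∈ range a, (q k).eval y :=
        Finset.one_le_prod fun k _ => hqn k y hy
      nlinarith
  · have hWL : (W : ℝ) < L := Nat.lt_ceil.mp haW
    -- When `W < log s`, degree `W ≤ √(W log s)` is affordable: every integer `1, …, W` becomes a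
    -- root.
    set R := C s * ∏ k ∈ range W, (C 1 + C (-(1 / ((k : ℝ) + 1))) * X) with hR
    have heval : ∀ y : ℝ, R.eval y = s * ∏ k ∈ range W, (1 + -(1 / ((k : ℝ) + 1)) * y) :=
      fun y => by simp [hR, eval_prod]
    refine ⟨R, ?_, fun y hy hyW => ?_, fun y hy => ?_⟩
    · have h1 : R.natDegree ≤ W := by
        refine (natDegree_C_mul_le _ _).trans ((natDegree_prod_le _ _).trans ?_)
        refine (sum_le_sum fun k _ => (show _ ≤ 1 by compute_degree)).trans ?_
        simp
      have h2 : (W : ℝ) ≤ √(W * L) := Real.le_sqrt_of_sq_le (by nlinarith)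
      have h3 : (R.natDegree : ℝ) ≤ W := by exact_mod_cast h1
      linarith [Real.sqrt_nonneg (W * L)]
    · rw [heval, prod_eq_zero (mem_range.mpr (show y - 1 < W by omega))]
      · simp
      · rw [Nat.cast_sub hy]
        have : (0 : ℝ) < y := by exact_mod_cast hy
        push_cast
        rw [sub_add_cancel, neg_mul, one_div, inv_mul_cancel₀ this.ne', add_neg_cancel]
    · rw [heval]
      have h2 : 1 ≤ ∏ k ∈ range W, (1 + -(1 / ((k : ℝ) + 1)) * y) :=
        Finset.one_le_prod fun k _ => by
          have : 0 ≤ 1 / ((k : ℝ) + 1) := by positivity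
          nlinarith
      nlinarith

/-! ### Small `s` and the choice of parameters -/

/-- For `s ≤ 2` a random constant polynomial already has the required behaviour. -/
lemma exists_constant_thresholdPTF (n : ℕ) {s : ℝ} (hs : 1 ≤ s) (hs2 : s ≤ 2) (t ε : ℝ) :
    ∃ D : ProbPoly n, D.DegreeLE 0 ∧ D.IsThresholdPTF s t ε := by
  classical
  -- Each of 0 and 2 has probability `1 / 2 ≥ 1 - 1 / s`. Degree 0 matters because the bound in (1)
  -- vanishes at `s = 1`.
  set P : Bool → MvPolynomial (Fin n) ℝ := fun b => MvPolynomial.C (if b then 2 else 0) with hP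
  have hev : ∀ b (x : Fin n → Bool), evalBits (P b) x = if b then 2 else 0 := fun b x => by
    simp [hP, evalBits]
  have hprob : ∀ (E : MvPolynomial (Fin n) ℝ → Prop) (b : Bool), E (P b) →
      ENNReal.ofReal (1 - 1 / s) ≤ (seedPoly P).prob E := fun E b hb => by
    refine le_prob_seedPoly P E _ ?_
    have h1 : (univ.filter fun b => ¬ E (P b)).card ≤ 1 := by
      refine card_le_one.mpr fun i hi j hj => ?_
      rw [mem_filter] at hi hj
      have hi' : i ≠ b := fun h => hi.2 (h ▸ hb)
      have hj' : j ≠ b := fun h => hj.2 (h ▸ hb)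
      revert hi' hj'
      cases i <;> cases j <;> cases b <;> simp
    have h2 : ((univ.filter fun b => ¬ E (P b)).card : ℝ) ≤ 1 := by exact_mod_cast h1
    have h3 : 1 / 2 ≤ 1 / s := one_div_le_one_div_of_le (by linarith) hs2
    rw [Fintype.card_bool]
    push_cast
    linarith
  refine ⟨seedPoly P, degreeLE_seedPoly fun b => by simp [hP], fun x =>
    ⟨fun _ => hprob _ false ?_, fun _ _ => hprob _ true ?_, fun _ => hprob _ true ?_⟩⟩
  · simp [hev]
  · simp [hev]
  · simpa [hev] using hs2

/-- With `u = ε^(-1/3)` and `r ≈ L u²`, the sample factor has degree `O(u L)`. The window has length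
`O(n / u)`, so the gap `ε n` is at least of order `u^(-2)` relative to it, and Chebyshev degree `O(u
L)` suffices. -/
lemma exists_thresholdPTF_additive_gap {n : ℕ} (hn : 0 < n) {s : ℝ} (hs : 2 ≤ s) (t : ℝ) {ε : ℝ}
    (hε : 0 < ε) (hε1 : ε ≤ 1) :
    ∃ D : ProbPoly n, D.DegreeLE (1000 * (1 / ε) ^ (1 / 3 : ℝ) * Real.log s) ∧
      D.IsThresholdPTF s t ε := by
  have hn' : (0 : ℝ) < n := by exact_mod_cast hn
  have hs0 : 0 < s := by linarith
  have hL : 0.69 < Real.log s :=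
    lt_of_lt_of_le (by linarith [Real.log_two_gt_d9]) (Real.log_le_log two_pos hs)
  have hL2 : Real.log (2 * s) ≤ 2 * Real.log s := by
    rw [Real.log_mul two_ne_zero hs0.ne']
    linarith [Real.log_le_log two_pos hs]
  set L := Real.log s with hLdef
  have hL0 : 0 < L := by linarith
  set u := (1 / ε) ^ (1 / 3 : ℝ) with hu
  have hu1 : 1 ≤ u := Real.one_le_rpow (by rwa [le_div_iff₀ hε, one_mul]) (by norm_num)
  have hu0 : 0 < u := by linarith
  have hu3 : u ^ 3 * ε = 1 := by
    rw [hu, ← Real.rpow_natCast, ← Real.rpow_mul (by positivity)]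
    norm_num
    field_simp
  set r := ⌈L * u ^ 2⌉₊ with hr
  have hLu : 0 < L * u ^ 2 := by positivity
  have hr0 : 0 < r := Nat.ceil_pos.mpr hLu
  have hr0' : (0 : ℝ) < r := by exact_mod_cast hr0
  have hr1 : L * u ^ 2 ≤ r := Nat.le_ceil _
  have hr2 : (r : ℝ) ≤ 3 * (L * u ^ 2) := by
    have := Nat.ceil_lt_add_one hLu.le
    nlinarith
  set V := √(6 * L / r) with hV
  have hV0 : 0 < V := Real.sqrt_pos.mpr (by positivity)
  have hVu : V * u ≤ 3 := by
    have h1 : (V * u) ^ 2 ≤ 3 ^ 2 := by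
      rw [mul_pow, hV, Real.sq_sqrt (by positivity), div_mul_eq_mul_div, div_le_iff₀ hr0']
      nlinarith
    exact le_of_sq_le_sq h1 (by norm_num)
  set W := 2 * n * V with hW
  have hW0 : 0 < W := by positivity
  set d := ⌈4 * u * L⌉₊ with hd
  have hd0 : 0 < d := Nat.ceil_pos.mpr (by positivity)
  have hd1 : 4 * u * L ≤ d := Nat.le_ceil _
  have hd2 : (d : ℝ) ≤ 4 * u * L + 1 := (Nat.ceil_lt_add_one (by positivity)).le
  have heval : ∀ k : ℝ, (affineChebyshev d (1 - 2 * t / W) (2 / W)).eval k =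
      (Chebyshev.T ℝ d).eval (1 + 2 * (k - t) / W) := fun k => by
    rw [eval_affineChebyshev]
    congr 1
    ring
  have hlow : ∀ k : ℕ, k ≤ n → t - W < k → (k : ℝ) ≤ t →
      |(affineChebyshev d (1 - 2 * t / W) (2 / W)).eval (k : ℝ)| ≤ 1 := fun k _ hk1 hk2 => by
    rw [heval]
    refine Chebyshev.abs_eval_T_real_le_one _ (abs_le.mpr ?_)
    have h1 : 2 * (k - t) / W ≤ 0 := div_nonpos_of_nonpos_of_nonneg (by linarith) hW0.le
    have h2 : -2 ≤ 2 * (k - t) / W := by rw [le_div_iff₀ hW0]; linarith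
    exact ⟨by linarith, by linarith⟩
  have hmid : ∀ k : ℕ, k ≤ n → t < k → (k : ℝ) < t + ε * n →
      1 < (affineChebyshev d (1 - 2 * t / W) (2 / W)).eval (k : ℝ) := fun k _ hk1 _ => by
    rw [heval]
    have h1 : 0 < 2 * (k - t) / W := div_pos (by linarith) hW0
    exact Chebyshev.one_lt_eval_T_real (by omega) (by linarith)
  have hhigh : ∀ k : ℕ, k ≤ n → t < k → t + ε * n ≤ k →
      s ≤ (affineChebyshev d (1 - 2 * t / W) (2 / W)).eval (k : ℝ) := fun k _ _ hk2 => by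
    rw [heval]
    -- `V ≤ 3 / u` and `ε = u^(-3)` give `ε / V ≥ 1 / (3u²)`, which exceeds this `δ`; and `d √δ ≥ 2
    -- L`.
    refine le_eval_chebyshev d (δ := (1 / (2 * u)) ^ 2) (by positivity) ?_ ?_ hs0 ?_
    · rw [sq_le_one_iff₀ (by positivity), div_le_one (by positivity)]
      linarith
    · have h1 : (1 / (2 * u)) ^ 2 ≤ ε / V := by
        rw [le_div_iff₀ hV0, div_pow, one_pow, div_mul_eq_mul_div, one_mul,
          div_le_iff₀ (by positivity)]
        nlinarith
      have h2 : ε / V ≤ 2 * (k - t) / W := by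
        rw [div_le_div_iff₀ hV0 hW0, hW]
        nlinarith
      linarith
    · rw [Real.sqrt_sq (by positivity)]
      calc Real.log (2 * s) ≤ 2 * L := hL2
        _ = 4 * u * L * (1 / (2 * u)) := by field_simp; ring
        _ ≤ _ := by gcongr
  obtain ⟨D, hD1, hD2⟩ := exists_thresholdPTF_of_window hn hr0 hs t ε _ hlow hmid hhigh hε
  refine ⟨D, fun p hp => (hD1 p hp).trans ?_, hD2⟩
  have h1 : √(r * (2 * L)) ≤ 3 * (u * L) := by
    rw [Real.sqrt_le_iff]
    refine ⟨by positivity, ?_⟩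
    have : (r : ℝ) * (2 * L) ≤ 3 * (L * u ^ 2) * (2 * L) := by gcongr
    nlinarith [sq_nonneg (u * L)]
  have h2 : ((affineChebyshev d (1 - 2 * t / W) (2 / W)).natDegree : ℝ) ≤ d := by
    exact_mod_cast natDegree_affineChebyshev_le _ _ _
  have h3 : 0.69 ≤ u * L := by nlinarith
  nlinarith

/-- Balancing `√(r L)` against `√(W L)` with `W ≈ n √(L / r)` gives `r ≈ n^(2/3) L^(1/3)`, so both
degrees are `O(n^(1/3) L^(2/3))` with `L = log s ≤ log (n s)`. -/
lemma exists_thresholdPTF_exact {n : ℕ} (hn : 0 < n) {s : ℝ} (hs : 2 ≤ s) (t : ℝ) :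
    ∃ D : ProbPoly n, D.DegreeLE (1000 * (n : ℝ) ^ (1 / 3 : ℝ) * Real.log (n * s) ^ (2 / 3 : ℝ)) ∧
      D.IsThresholdPTF s t (1 / n) := by
  have hn' : (1 : ℝ) ≤ n := by exact_mod_cast hn
  have hs0 : 0 < s := by linarith
  have hL : 0.69 < Real.log s :=
    lt_of_lt_of_le (by linarith [Real.log_two_gt_d9]) (Real.log_le_log two_pos hs)
  have hLn : Real.log s ≤ Real.log (n * s) := Real.log_le_log hs0 (by nlinarith)
  set L := Real.log s with hLdef
  have hL0 : 0 < L := by linarith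
  set v := (n : ℝ) ^ (1 / 3 : ℝ) with hv
  set z := L ^ (1 / 3 : ℝ) with hz
  have hv1 : 1 ≤ v := Real.one_le_rpow hn' (by norm_num)
  have hv3 : v ^ 3 = n := by
    rw [hv, ← Real.rpow_natCast, ← Real.rpow_mul (by positivity)]
    norm_num
  have hz0 : 0 < z := Real.rpow_pos_of_pos hL0 _
  have hz3 : z ^ 3 = L := by
    rw [hz, ← Real.rpow_natCast, ← Real.rpow_mul (by positivity)]
    norm_num
  have hz2 : z ^ 2 ≤ Real.log (n * s) ^ (2 / 3 : ℝ) := by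
    rw [hz, ← Real.rpow_natCast, ← Real.rpow_mul (by positivity)]
    norm_num
    exact Real.rpow_le_rpow hL0.le hLn (by norm_num)
  have hz1 : 0.8 ≤ z := by
    by_contra! h
    have : z ^ 3 < 0.8 ^ 3 := by gcongr
    norm_num at this
    linarith
  have hvz1 : 0.8 ≤ v ^ 2 * z := by nlinarith
  set r := ⌈v ^ 2 * z⌉₊ with hr
  have hvz : 0 < v ^ 2 * z := by positivity
  have hr0 : 0 < r := Nat.ceil_pos.mpr hvz
  have hr0' : (0 : ℝ) < r := by exact_mod_cast hr0
  have hr1 : v ^ 2 * z ≤ r := Nat.le_ceil _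
  have hr2 : (r : ℝ) ≤ 3 * (v ^ 2 * z) := by
    have := Nat.ceil_lt_add_one hvz.le
    linarith
  set V := √(6 * L / r) with hV
  have hVv : V * v ≤ 3 * z := by
    refine le_of_sq_le_sq ?_ (by positivity)
    rw [mul_pow, hV, Real.sq_sqrt (by positivity), div_mul_eq_mul_div, div_le_iff₀ hr0', ← hz3]
    have : (3 * z) ^ 2 * (v ^ 2 * z) ≤ (3 * z) ^ 2 * r := by gcongr
    nlinarith [mul_nonneg (pow_nonneg hz0.le 3) (sq_nonneg v)]
  -- In the variable `y = ⌊t⌋ + 1 - k`, `k ≤ t` means `y ≥ 1` and `k > t` means `y ≤ 0`. The extra 1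
  -- absorbs this shift: `k > t - 2nV` gives `y < 2nV + 1 ≤ W`.
  set W := ⌈2 * n * V⌉₊ + 1 with hW
  have hW1 : 2 * n * V + 1 ≤ W := by
    rw [hW]; push_cast; linarith [Nat.le_ceil (2 * n * V)]
  have hW2 : (W : ℝ) ≤ 9 * (v ^ 2 * z) := by
    have h1 : (W : ℝ) < 2 * n * V + 2 := by
      rw [hW]; push_cast
      linarith [Nat.ceil_lt_add_one (show 0 ≤ 2 * n * V by positivity)]
    have h2 : 2 * n * V ≤ 6 * (v ^ 2 * z) := by
      rw [← hv3]
      nlinarith [mul_le_mul_of_nonneg_left hVv (sq_nonneg v)]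
    linarith
  obtain ⟨R, hR1, hR2, hR3⟩ := exists_poly_integer_gap (W := W) (by omega) hs
  have heval : ∀ k : ℝ, (R.comp (C (⌊t⌋ + 1 : ℝ) - X)).eval k = R.eval (⌊t⌋ + 1 - k) :=
    fun k => by simp
  have hbig : ∀ k : ℕ, t < k → s ≤ (R.comp (C (⌊t⌋ + 1 : ℝ) - X)).eval (k : ℝ) := fun k hk => by
    rw [heval]
    refine hR3 _ ?_
    have h1 : ⌊t⌋ < (k : ℤ) := Int.floor_lt.mpr (by exact_mod_cast hk)
    have h2 : ((⌊t⌋ + 1 : ℤ) : ℝ) ≤ ((k : ℤ) : ℝ) := by exact_mod_cast h1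
    push_cast at h2
    linarith
  have hlow : ∀ k : ℕ, k ≤ n → t - 2 * n * V < k → (k : ℝ) ≤ t →
      |(R.comp (C (⌊t⌋ + 1 : ℝ) - X)).eval (k : ℝ)| ≤ 1 := fun k _ hk1 hk2 => by
    rw [heval]
    have h1 : (k : ℤ) ≤ ⌊t⌋ := Int.le_floor.mpr (by exact_mod_cast hk2)
    obtain ⟨y, hy⟩ := Int.eq_ofNat_of_zero_le (show 0 ≤ ⌊t⌋ + 1 - k by omega)
    have hy' : (⌊t⌋ + 1 - k : ℝ) = y := by exact_mod_cast hy
    rw [hy']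
    refine hR2 y (by omega) ?_
    have h2 : (y : ℝ) ≤ W := by
      rw [← hy']
      linarith [Int.floor_le t]
    exact_mod_cast h2
  obtain ⟨D, hD1, hD2⟩ := exists_thresholdPTF_of_window hn hr0 hs t (1 / n) _ hlow
    (fun k _ hk1 _ => lt_of_lt_of_le (by linarith) (hbig k hk1)) (fun k _ hk _ => hbig k hk)
    (by positivity)
  refine ⟨D, fun p hp => (hD1 p hp).trans ?_, hD2⟩
  have h1 : √(r * (2 * L)) ≤ 3 * (v * z ^ 2) := by
    rw [Real.sqrt_le_iff]
    refine ⟨by positivity, ?_⟩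
    have : (r : ℝ) * (2 * L) ≤ 3 * (v ^ 2 * z) * (2 * z ^ 3) := by rw [hz3]; gcongr
    nlinarith [sq_nonneg (v * z ^ 2)]
  have h2 : √(W * L) ≤ 3 * (v * z ^ 2) := by
    rw [Real.sqrt_le_iff]
    refine ⟨by positivity, ?_⟩
    have : (W : ℝ) * L ≤ 9 * (v ^ 2 * z) * z ^ 3 := by rw [hz3]; gcongr
    nlinarith
  have h3 : ((R.comp (C (⌊t⌋ + 1 : ℝ) - X)).natDegree : ℝ) ≤ R.natDegree := by
    have e1 : (C (⌊t⌋ + 1 : ℝ) - X : ℝ[X]).natDegree ≤ 1 := by compute_degree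
    have e2 := natDegree_comp_le (p := R) (q := C (⌊t⌋ + 1 : ℝ) - X)
    exact_mod_cast e2.trans (by simpa using Nat.mul_le_mul_left R.natDegree e1)
  have h4 : v * z ^ 2 ≤ v * Real.log (n * s) ^ (2 / 3 : ℝ) := by gcongr
  have h5 : 0 ≤ v * z ^ 2 := by positivity
  linarith

theorem theorem3 :
    ∃ C : ℝ, 0 < C ∧
      (∀ (n : ℕ) (s t ε : ℝ), 1 ≤ n → 1 ≤ s → 0 < ε → ε ≤ 1 →
        ∃ D : ProbPoly n,
          D.DegreeLE (C * (1 / ε) ^ (1 / 3 : ℝ) * Real.log s) ∧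
          D.IsThresholdPTF s t ε) ∧
      (∀ (n : ℕ) (s t : ℝ), 1 ≤ n → 1 ≤ s →
        ∃ D : ProbPoly n,
          D.DegreeLE (C * (n : ℝ) ^ (1 / 3 : ℝ) * Real.log (n * s) ^ (2 / 3 : ℝ)) ∧
          D.IsThresholdPTF s t (1 / n)) := by
  refine ⟨1000, by norm_num, fun n s t ε hn hs hε hε1 => ?_, fun n s t hn hs => ?_⟩
  · rcases le_total 2 s with h2 | h2
    · exact exists_thresholdPTF_additive_gap hn h2 t hε hε1
    · obtain ⟨D, hD1, hD2⟩ := exists_constant_thresholdPTF n hs h2 t ε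
      have := Real.log_nonneg hs
      exact ⟨D, fun p hp => (hD1 p hp).trans (by positivity), hD2⟩
  · rcases le_total 2 s with h2 | h2
    · exact exists_thresholdPTF_exact hn h2 t
    · obtain ⟨D, hD1, hD2⟩ := exists_constant_thresholdPTF n hs h2 t (1 / n)
      have hn' : (1 : ℝ) ≤ n := by exact_mod_cast hn
      have := Real.log_nonneg (one_le_mul_of_one_le_of_one_le hn' hs)
      exact ⟨D, fun p hp => (hD1 p hp).trans (by positivity), hD2⟩
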